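/- Let $H$ be a real or complex Hilbert space and let $Z:H\supset D(Z)\to H$ be a densely defined linear operator that is dissipative, i.e. $\operatorname{Re}\langle Zx,x\rangle\le 0$ for all $x\in D(Z)$. Let $\mathcal L(H)$ be the space of bounded linear operators on $H$. Let $\mathcal F_H$ be the set of all functions $F:[0,\infty)\to\mathcal L(H)$ such that (a) $F(0)=I$; (b) for each $s\ge 0$ the family $\{F(d/n)^m : n,m\in\mathbb N,\ d\ge 0,\ md/n\le s\}$ is equicontinuous, i.e. bounded in operator norm; (c) the set of all $x\in H$ for which there is a family $(x_s)_{s>0}$ in $H$ such that $\lim_{s\to0+}x_s=x$ and $\lim_{s\to 0+}s^{-1}(F(s)-F(0))x_s$ exists is dense in $H$. For such $F$ let $F'(0)$ be the operator $F'(0)x=\lim_{s\to0+}s^{-1}(F(s)x-F(0)x)$, whose domain is the set of all $x\in H$ for which this limit exists. Then: 1. $Z$ is closable; denote its closure by $\overline Z$. 2. There exists $F\in\mathcal F_H$ such that $F'(0)|_{D(Z)}=Z$ (i.e. $D(Z)\subset D(F'(0))$ and $F'(0)x=Zx$ for $x\in D(Z)$). 3. Let $F\in\mathcal F_H$ be any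 function with $F'(0)|_{D(Z)}=Z$, let $l>0$, and let $f:[0,l)\to H$ be a local solution of $$f'(t)=\overline Z f(t),\quad t\in[0,l),\qquad f(0)=h\in D(\overline Z),$$ i.e. $f(0)=h$ and for every $t\in[0,l)$ one has $f(t)\in D(\overline Z)$ and $f$ is differentiable at $t$ (from the right if $t=0$) with $f'(t)=\overline Zf(t)$. Then, for every $t_0\in(0,l)$, $F(t/n)^n h\to f(t)$ as $n\to\infty$ uniformly with respect to $t\in[0,t_0]$. (It is not assumed that $\overline Z$ generates a $C_0$-semigroup.) -/

import Mathlib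

open Filter Set
open scoped Topology NNReal

namespace ChernoffHilbert

section Operators

variable {𝕜 E : Type*} [RCLike 𝕜] [NormedAddCommGroup E] [NormedSpace 𝕜 E]

/-- The family of operators `F (d / n) ^ m` with `n, m ≥ 1` natural, `d ≥ 0` real and
`m * d / n ≤ s`. -/
def powerFamily (F : ℝ≥0 → E →L[𝕜] E) (s : ℝ≥0) : Set (E →L[𝕜] E) :=
  {G | ∃ (n m : ℕ) (d : ℝ≥0), 1 ≤ n ∧ 1 ≤ m ∧ (m : ℝ≥0) * d / n ≤ s ∧ G = F (d / n) ^ m}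

/-- Equicontinuity of a family of bounded operators, with the topology given by the norm. -/
def IsEquicontinuousFamily (B : Set (E →L[𝕜] E)) : Prop :=
  ∃ b : ℝ, 0 < b ∧ ∀ G ∈ B, ∀ x : E, ‖G x‖ ≤ b * ‖x‖

/-- The class of functions `F : [0, ∞) → L(E)` with `F 0 = I` all of whose families
`powerFamily F s` are equicontinuous. -/
def ClassE (F : ℝ≥0 → E →L[𝕜] E) : Prop :=
  F 0 = 1 ∧ ∀ s : ℝ≥0, IsEquicontinuousFamily (powerFamily F s)

/-- The difference quotient `s⁻¹ (F s - F 0) x`. -/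
noncomputable def diffQuot (F : ℝ≥0 → E →L[𝕜] E) (s : ℝ≥0) (x : E) : E :=
  (((s : ℝ) : 𝕜))⁻¹ • (F s x - F 0 x)

/-- The many-valued effective derivative of `F` at `0`: the set of its values at `x`. -/
def effDeriv (F : ℝ≥0 → E →L[𝕜] E) (x : E) : Set E :=
  {g | ∃ u : ℝ≥0 → E, Tendsto u (𝓝[>] 0) (𝓝 x) ∧
    Tendsto (fun s => diffQuot F s (u s)) (𝓝[>] 0) (𝓝 g)}

/-- The domain of the many-valued effective derivative of `F` at `0`. -/
def effDerivDomain (F : ℝ≥0 → E →L[𝕜] E) : Set E :=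
  {x | (effDeriv F x).Nonempty}

/-- The functions in `ClassE` whose many-valued effective derivative at `0` is densely defined. -/
def ClassF (F : ℝ≥0 → E →L[𝕜] E) : Prop :=
  ClassE F ∧ Dense (effDerivDomain F)

theorem diffQuot_add (F : ℝ≥0 → E →L[𝕜] E) (s : ℝ≥0) (x y : E) :
    diffQuot F s (x + y) = diffQuot F s x + diffQuot F s y := by
  simp only [diffQuot, map_add, ← smul_add]
  congr 1
  abel

theorem diffQuot_smul (F : ℝ≥0 → E →L[𝕜] E) (s : ℝ≥0) (c : 𝕜) (x : E) :
    diffQuot F s (c • x) = c • diffQuot F s x := by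
  simp only [diffQuot, map_smul, ← smul_sub]
  rw [smul_comm]

/-- The strong derivative `F'(0)` as an unbounded operator: its domain consists of all `x` for
which `s⁻¹ (F s x - F 0 x)` converges as `s → 0`, and `F'(0) x` is the limit. -/
noncomputable def strongDeriv (F : ℝ≥0 → E →L[𝕜] E) : E →ₗ.[𝕜] E where
  domain :=
    { carrier := {x | ∃ g, Tendsto (fun s => diffQuot F s x) (𝓝[>] 0) (𝓝 g)}
      add_mem' := by
        rintro x y ⟨g, hg⟩ ⟨k, hk⟩
        refine ⟨g + k, ?_⟩
        simpa only [diffQuot_add] using hg.add hk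
      zero_mem' := ⟨0, by simp [diffQuot]⟩
      smul_mem' := by
        rintro c x ⟨g, hg⟩
        refine ⟨c • g, ?_⟩
        simpa only [diffQuot_smul] using hg.const_smul c }
  toFun :=
    { toFun := fun x => Classical.choose x.2
      map_add' := by
        intro x y
        refine tendsto_nhds_unique (Classical.choose_spec (x + y).2) ?_
        have h := (Classical.choose_spec x.2).add (Classical.choose_spec y.2)
        simpa only [Submodule.coe_add, diffQuot_add] using h
      map_smul' := by
        intro c x
        refine tendsto_nhds_unique (Classical.choose_spec (c • x).2) ?_
        have h := (Classical.choose_spec x.2).const_smul c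
        simpa only [Submodule.coe_smul, diffQuot_smul, RingHom.id_apply] using h }

/-- `strongDeriv F` is the operator it is meant to be. -/
theorem strongDeriv_spec (F : ℝ≥0 → E →L[𝕜] E) (x : (strongDeriv F).domain) :
    Tendsto (fun s => diffQuot F s (x : E)) (𝓝[>] 0) (𝓝 (strongDeriv F x)) :=
  Classical.choose_spec x.2

theorem mem_strongDeriv_domain (F : ℝ≥0 → E →L[𝕜] E) (x : E) :
    x ∈ (strongDeriv F).domain ↔ ∃ g, Tendsto (fun s => diffQuot F s x) (𝓝[>] 0) (𝓝 g) :=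
  Iff.rfl

/-- `f : [0, l) → E` is a local solution of `f'(t) = A f(t)`, `f(0) = h`, on `[0, l)`, where `l > 0`
(values of `f` outside `[0, l)` play no role; the derivative at `0` is one-sided). -/
structure IsLocalSolution (A : E →ₗ.[𝕜] E) (l : ℝ) (h : E) (f : ℝ → E) : Prop where
  pos : 0 < l
  init : f 0 = h
  mem : ∀ t ∈ Ico 0 l, f t ∈ A.domain
  hasDeriv : letI : NormedSpace ℝ E := NormedSpace.restrictScalars ℝ 𝕜 E
    ∀ (t : ℝ) (ht : t ∈ Ico 0 l), HasDerivWithinAt f (A ⟨f t, mem t ht⟩) (Ico 0 l) t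

end Operators

/-- A linear operator `Z` in an inner product space is dissipative if `Re ⟪Z x, x⟫ ≤ 0` for every
`x` in its domain. -/
def IsDissipative {𝕜 H : Type*} [RCLike 𝕜] [NormedAddCommGroup H] [InnerProductSpace 𝕜 H]
    (Z : H →ₗ.[𝕜] H) : Prop :=
  ∀ x : Z.domain, RCLike.re (inner 𝕜 (Z x) (x : H)) ≤ 0

end ChernoffHilbert

/-!
Closability holds because `Re ⟪y, x⟫ ≤ 0` is a closed condition on points `(x, y)` of the graph: if
`(0, y)` is in the closure of the graph, perturbing it by small multiples of `(v, Z v)` gives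
`Re ⟪y, v⟫ ≤ 0` for all `v` in the dense domain, so `y = 0`.

For the existence of `F` no semigroup is needed. Dissipativity gives `‖x‖ ≤ ‖x - s Z x‖`, so there
is a contraction `F s` of `H` that inverts `1 - s Z` on its range
(`exists_contraction_comp_eq`). From `F s x - x = s F s (Z x)` one reads off first that `F s → 1`
strongly, then that the difference quotients converge to `Z x`.

For the convergence, let `τ` be the step size and let `P` be the average of `F τ ^ k` over the times
`k τ` in `[0, δ)`, with `δ` fixed (`timeAverage`). It commutes with `F τ`, and
`P (F τ - 1) / τ = (F τ ^ N - 1) / (N τ)` is bounded uniformly in `τ`. So although the difference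
quotients of `F` need not converge on the domain of the closure of `Z`, their averages are consistent
with it: `P ((F τ - 1) / τ x - y) → 0` for `(x, y)` in the closure of the graph
(`IsPowerBound.tendsto_timeAverage_diffQuot_sub`). Dissipativity enters once more:
the distance between a local solution `f` and its translates does not increase, so `f'` is bounded by
`‖f' 0‖` (`IsDissipative.norm_deriv_le`). The error `F τ ^ m (f 0) - f (m τ)` telescopes, and
after applying `P` it is dominated by a multiple of `∫ ‖P ((F τ - 1) / τ (f r) - f' r)‖ dr + O(τ)`, which tends to
`0` by dominated convergence
(`IsPowerBound.eventually_norm_timeAverage_error_le`). Since `P` commutes with `F τ ^ m`,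
it can be removed: it is close to `1` on `f 0` and uniformly on the compact range of `f` when `δ` is
small (`ClassE.eventually_norm_error_le`).
-/

namespace ChernoffHilbert

/-! ### Dissipative operators and their closures -/

section Dissipative

variable {𝕜 H : Type*} [RCLike 𝕜] [NormedAddCommGroup H] [InnerProductSpace 𝕜 H]

/-- Dissipativity is a closed condition on points of the graph, so it passes to the closure. -/
theorem IsDissipative.re_inner_nonpos_of_mem_graph_closure {Z : H →ₗ.[𝕜] H}
    (hZ : IsDissipative Z) {p : H × H} (hp : p ∈ Z.graph.topologicalClosure) :
    RCLike.re (inner 𝕜 p.2 p.1) ≤ 0 := by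
  have hclosed : IsClosed {q : H × H | RCLike.re (inner 𝕜 q.2 q.1) ≤ 0} :=
    isClosed_le (RCLike.continuous_re.comp (continuous_snd.inner continuous_fst)) continuous_const
  refine closure_minimal ?_ hclosed hp
  rintro ⟨x, y⟩ hxy
  obtain ⟨u, rfl, rfl⟩ := (LinearPMap.mem_graph_iff Z).1 hxy
  exact hZ u

theorem IsDissipative.isClosable {Z : H →ₗ.[𝕜] H} (hdense : Dense (Z.domain : Set H))
    (hZ : IsDissipative Z) : Z.IsClosable := by
  refine ⟨_, (Submodule.toLinearPMap_graph_eq Z.graph.topologicalClosure ?_).symm⟩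
  rintro ⟨x, y⟩ hxy hx
  obtain rfl : x = 0 := hx
  -- Perturbing `(0, y)` by `c • (v, Z v)` and letting `c → 0` gives `Re ⟪y, v⟫ ≤ 0`.
  have key : ∀ v : Z.domain, RCLike.re (inner 𝕜 y (v : H)) ≤ 0 := by
    intro v
    have hpos : ∀ c : ℝ, 0 < c →
        RCLike.re (inner 𝕜 y (v : H)) + c * RCLike.re (inner 𝕜 (Z v) (v : H)) ≤ 0 := by
      intro c hc
      have hmem := add_mem hxy (Submodule.smul_mem _ (c : 𝕜)
        (Z.graph.le_topologicalClosure (Z.mem_graph v)))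
      have h := hZ.re_inner_nonpos_of_mem_graph_closure hmem
      have heq : RCLike.re (inner 𝕜 (y + (c : 𝕜) • Z v) ((0 : H) + (c : 𝕜) • (v : H)))
          = c * (RCLike.re (inner 𝕜 y (v : H)) + c * RCLike.re (inner 𝕜 (Z v) (v : H))) := by
        simp only [zero_add, inner_smul_right, inner_add_left, inner_smul_left,
          RCLike.conj_ofReal, RCLike.re_ofReal_mul, map_add]
      exact nonpos_of_mul_nonpos_right (heq ▸ h) hc
    have hlim : Tendsto (fun c : ℝ => RCLike.re (inner 𝕜 y (v : H))
        + c * RCLike.re (inner 𝕜 (Z v) (v : H))) (𝓝[>] 0)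
        (𝓝 (RCLike.re (inner 𝕜 y (v : H)) + 0 * RCLike.re (inner 𝕜 (Z v) (v : H)))) :=
      ((continuous_const.add (continuous_id.mul continuous_const)).tendsto 0).mono_left
        nhdsWithin_le_nhds
    simpa using le_of_tendsto hlim (eventually_mem_nhdsWithin.mono hpos)
  have hall : ∀ w : H, RCLike.re (inner 𝕜 y w) ≤ 0 := fun w =>
    hdense.induction (P := fun w => RCLike.re (inner 𝕜 y w) ≤ 0) (fun v hv => key ⟨v, hv⟩)
      (isClosed_le (RCLike.continuous_re.comp (continuous_const.inner continuous_id))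
        continuous_const) w
  have hy := hall y
  rw [inner_self_eq_norm_mul_norm] at hy
  exact norm_eq_zero.1 (mul_self_eq_zero.1 (le_antisymm hy (mul_self_nonneg _)))

theorem IsDissipative.closure {Z : H →ₗ.[𝕜] H} (hdense : Dense (Z.domain : Set H))
    (hZ : IsDissipative Z) : IsDissipative Z.closure := by
  intro x
  have hx := Z.closure.mem_graph x
  rw [← (hZ.isClosable hdense).graph_closure_eq_closure_graph] at hx
  exact hZ.re_inner_nonpos_of_mem_graph_closure hx

theorem IsDissipative.norm_le_norm_sub_smul {Z : H →ₗ.[𝕜] H} (hZ : IsDissipative Z) {s : ℝ}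
    (hs : 0 ≤ s) (x : Z.domain) : ‖(x : H)‖ ≤ ‖(x : H) - (s : 𝕜) • Z x‖ := by
  have h1 : ‖(x : H)‖ * ‖(x : H)‖ ≤ ‖(x : H) - (s : 𝕜) • Z x‖ * ‖(x : H)‖ := by
    refine le_trans ?_ (re_inner_le_norm (𝕜 := 𝕜) _ _)
    rw [inner_sub_left, inner_smul_left, RCLike.conj_ofReal, map_sub, RCLike.re_ofReal_mul,
      inner_self_eq_norm_mul_norm]
    nlinarith [hZ x]
  rcases (norm_nonneg (x : H)).eq_or_lt with h0 | h0
  · exact h0 ▸ norm_nonneg _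
  · exact le_of_mul_le_mul_right h1 h0

end Dissipative

/-! ### A Chernoff function for a dissipative operator -/

section Existence

variable {𝕜 H : Type*} [RCLike 𝕜] [NormedAddCommGroup H] [InnerProductSpace 𝕜 H]
  [CompleteSpace H]

/-- If `‖R x‖ ≤ ‖S x‖` for all `x`, then `R` factors through `S` by a contraction of the whole
Hilbert space, vanishing on the orthogonal complement of the range of `S`. -/
theorem exists_contraction_comp_eq {V : Type*} [AddCommGroup V] [Module 𝕜 V] (S R : V →ₗ[𝕜] H)
    (h : ∀ x, ‖R x‖ ≤ ‖S x‖) :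
    ∃ T : H →L[𝕜] H, (∀ y, ‖T y‖ ≤ ‖y‖) ∧ ∀ x, T (S x) = R x := by
  let K : Submodule 𝕜 H := (LinearMap.range S).topologicalClosure
  have hK : ∀ x, S x ∈ K := fun x => Submodule.le_topologicalClosure _ ⟨x, rfl⟩
  have : CompleteSpace K := (Submodule.isClosed_topologicalClosure _).completeSpace_coe
  let e : V →ₗ[𝕜] K := S.codRestrict K hK
  have hdense : DenseRange e := by
    have hsub : closure (Subtype.val '' range e) = (K : Set H) := by
      rw [← range_comp, Submodule.topologicalClosure_coe]
      rfl
    intro y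
    rw [closure_subtype, hsub]
    exact y.2
  have hbound : ∀ x, ‖R x‖ ≤ 1 * ‖e x‖ := fun x => by simpa [e] using h x
  refine ⟨(R.extendOfNorm e).comp K.orthogonalProjectionOnto, fun y => ?_, fun x => ?_⟩
  · refine (LinearMap.norm_extendOfNorm_apply_le hdense 1 hbound _).trans ?_
    rw [one_mul]
    exact K.norm_orthogonalProjectionOnto_apply_le y
  · have hx : K.orthogonalProjectionOnto (S x) = e x :=
      K.orthogonalProjectionOnto_mem_subspace_eq_self (e x)
    rw [ContinuousLinearMap.comp_apply, hx]
    exact LinearMap.extendOfNorm_eq hdense ⟨1, hbound⟩ x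

/-- The existence of a Chernoff function with derivative `Z` on the domain of `Z`: for `s > 0` take
the contraction that inverts `1 - s Z` on its range. -/
theorem IsDissipative.exists_classF {Z : H →ₗ.[𝕜] H} (hdense : Dense (Z.domain : Set H))
    (hZ : IsDissipative Z) :
    ∃ F : ℝ≥0 → H →L[𝕜] H, ClassF F ∧ (strongDeriv F).domRestrict Z.domain = Z := by
  have hex : ∀ s : ℝ≥0, ∃ T : H →L[𝕜] H, (∀ y, ‖T y‖ ≤ ‖y‖) ∧
      ∀ x : Z.domain, T ((x : H) - ((s : ℝ) : 𝕜) • Z x) = x := fun s =>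
    exists_contraction_comp_eq (Z.domain.subtype - ((s : ℝ) : 𝕜) • Z.toFun) Z.domain.subtype
      (hZ.norm_le_norm_sub_smul s.2)
  choose F hFle hF using hex
  have hF0 : F 0 = 1 := by
    refine ContinuousLinearMap.coeFn_injective (hdense.denseRange_val.equalizer (F 0).continuous
      continuous_id (funext fun x => ?_))
    simpa using hF 0 x
  have hstep : ∀ (s : ℝ≥0) (x : Z.domain), F s (x : H) - x = ((s : ℝ) : 𝕜) • F s (Z x) := by
    intro s x
    have h := hF s x
    rw [map_sub, map_smul] at h
    rw [sub_eq_iff_eq_add, ← sub_eq_iff_eq_add', h]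
  have hpow : ∀ (s : ℝ≥0) (m : ℕ) (y : H), ‖(F s ^ m) y‖ ≤ ‖y‖ := by
    intro s m y
    induction m with
    | zero => simp
    | succ m ih =>
      rw [pow_succ', mul_apply_eq_comp]
      exact (hFle _ _).trans ih
  have hsmall : Tendsto (fun s : ℝ≥0 => (s : ℝ)) (𝓝[>] 0) (𝓝 0) :=
    (NNReal.continuous_coe.tendsto 0).mono_left nhdsWithin_le_nhds
  -- `F s → 1` strongly: on the domain of `Z` by `hstep`, everywhere by density and contractivity.
  have hstrong : ∀ y : H, Tendsto (fun s => F s y) (𝓝[>] 0) (𝓝 y) := by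
    intro y
    rw [Metric.tendsto_nhds]
    intro ε hε
    obtain ⟨v, hv, hyv⟩ := hdense.exists_dist_lt y (show 0 < ε / 4 by positivity)
    have hb : Tendsto (fun s : ℝ≥0 => (s : ℝ) * ‖Z ⟨v, hv⟩‖) (𝓝[>] 0) (𝓝 0) := by
      simpa using hsmall.mul_const ‖Z ⟨v, hv⟩‖
    filter_upwards [hb.eventually (gt_mem_nhds (show 0 < ε / 4 by positivity))] with s hs
    have h1 : ‖F s v - v‖ ≤ (s : ℝ) * ‖Z ⟨v, hv⟩‖ := by
      rw [hstep s ⟨v, hv⟩, norm_smul, RCLike.norm_ofReal, NNReal.abs_eq]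
      exact mul_le_mul_of_nonneg_left (hFle _ _) s.2
    have h2 : ‖F s (y - v)‖ ≤ ‖y - v‖ := hFle _ _
    have h3 : F s y - y = F s (y - v) + (F s v - v) - (y - v) := by
      rw [map_sub]; abel
    rw [dist_eq_norm] at hyv ⊢
    rw [h3]
    refine (norm_sub_le _ _).trans_lt ?_
    have := norm_add_le (F s (y - v)) (F s v - v)
    linarith
  have hderiv : ∀ x : Z.domain, Tendsto (fun s => diffQuot F s (x : H)) (𝓝[>] 0) (𝓝 (Z x)) := by
    intro x
    refine (hstrong (Z x)).congr' ?_
    filter_upwards [self_mem_nhdsWithin] with s hs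
    have hs' : ((s : ℝ) : 𝕜) ≠ 0 := by
      simpa using (show (0 : ℝ≥0) < s from hs).ne'
    rw [diffQuot, hF0, one_apply_eq_self, hstep, inv_smul_smul₀ hs']
  refine ⟨F, ⟨⟨hF0, fun s => ⟨1, one_pos, ?_⟩⟩, ?_⟩, ?_⟩
  · rintro G ⟨n, m, d, -, -, -, rfl⟩ x
    simpa using hpow _ m x
  · exact hdense.mono fun x hx => ⟨Z ⟨x, hx⟩, fun _ => x, tendsto_const_nhds, hderiv ⟨x, hx⟩⟩
  · have hdom : Z.domain ≤ (strongDeriv F).domain := fun x hx => ⟨_, hderiv ⟨x, hx⟩⟩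
    refine LinearPMap.ext (inf_eq_left.2 hdom) ?_
    intro x hx hx'
    refine (LinearPMap.domRestrict_apply (x := ⟨x, hx⟩) (y := ⟨x, hdom hx'⟩) rfl).trans ?_
    exact tendsto_nhds_unique (strongDeriv_spec F ⟨x, hdom hx'⟩) (hderiv ⟨x, hx'⟩)

end Existence

/-! ### Averages of powers of a bounded operator -/

section PowerAverage

variable {𝕜 E : Type*} [RCLike 𝕜] [NormedAddCommGroup E] [NormedSpace 𝕜 E]

/-- The ergodic average `N⁻¹ (1 + T + ⋯ + T ^ (N - 1))`; it is `0` when `N = 0`. -/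
noncomputable def powerAverage (T : E →L[𝕜] E) (N : ℕ) : E →L[𝕜] E :=
  (N : 𝕜)⁻¹ • ∑ k ∈ Finset.range N, T ^ k

theorem powerAverage_apply (T : E →L[𝕜] E) (N : ℕ) (x : E) :
    powerAverage T N x = (N : 𝕜)⁻¹ • ∑ k ∈ Finset.range N, (T ^ k) x := by
  simp [powerAverage]

theorem commute_powerAverage (T : E →L[𝕜] E) (N : ℕ) : Commute (powerAverage T N) T := by
  refine Commute.smul_left (Commute.sum_left _ _ _ fun k _ => ?_) _
  exact (Commute.refl T).pow_left k

theorem sum_pow_apply_sub (T : E →L[𝕜] E) (N : ℕ) (x : E) :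
    ∑ k ∈ Finset.range N, (T ^ k) (T x - x) = (T ^ N) x - x := by
  have h : ∀ k, (T ^ k) (T x - x) = (T ^ (k + 1)) x - (T ^ k) x := fun k => by
    rw [map_sub, pow_succ, mul_apply_eq_comp]
  simp only [h]
  rw [Finset.sum_range_sub (fun k => (T ^ k) x)]
  simp

theorem powerAverage_apply_sub (T : E →L[𝕜] E) (N : ℕ) (x : E) :
    powerAverage T N (T x - x) = (N : 𝕜)⁻¹ • ((T ^ N) x - x) := by
  rw [powerAverage_apply, sum_pow_apply_sub]

variable {T : E →L[𝕜] E} {N : ℕ} {M : ℝ}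

theorem norm_powerAverage_apply_le (hN : 1 ≤ N) (hM : ∀ k ≤ N, ∀ x, ‖(T ^ k) x‖ ≤ M * ‖x‖) (x : E) :
    ‖powerAverage T N x‖ ≤ M * ‖x‖ := by
  have hN' : (0 : ℝ) < N := by exact_mod_cast hN
  rw [powerAverage_apply, norm_smul, norm_inv, RCLike.norm_natCast, inv_mul_le_iff₀ hN']
  refine (norm_sum_le_of_le _ fun k hk => hM k (Finset.mem_range.1 hk).le x).trans_eq ?_
  simp

theorem norm_powerAverage_apply_sub_le (hM : ∀ k ≤ N, ∀ x, ‖(T ^ k) x‖ ≤ M * ‖x‖) (x : E) :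
    ‖powerAverage T N (T x - x)‖ ≤ (N : ℝ)⁻¹ * ((M + 1) * ‖x‖) := by
  rw [powerAverage_apply_sub, norm_smul, norm_inv, RCLike.norm_natCast]
  refine mul_le_mul_of_nonneg_left ((norm_sub_le _ _).trans ?_) (by positivity)
  linarith [hM N le_rfl x]

theorem norm_powerAverage_sub_self_le (hN : 1 ≤ N) (hM0 : 0 ≤ M)
    (hM : ∀ k ≤ N, ∀ x, ‖(T ^ k) x‖ ≤ M * ‖x‖) (x : E) :
    ‖powerAverage T N x - x‖ ≤ N * (M * ‖T x - x‖) := by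
  have hN' : (0 : ℝ) < N := by exact_mod_cast hN
  have hNk : (N : 𝕜) ≠ 0 := by exact_mod_cast hN'.ne'
  have hk : ∀ k ∈ Finset.range N, ‖(T ^ k) x - x‖ ≤ N * (M * ‖T x - x‖) := by
    intro k hk
    have hkN := (Finset.mem_range.1 hk).le
    rw [← sum_pow_apply_sub]
    refine (norm_sum_le_of_le _ fun j hj =>
      hM j ((Finset.mem_range.1 hj).le.trans hkN) (T x - x)).trans ?_
    rw [Finset.sum_const, Finset.card_range, nsmul_eq_mul]
    have : (k : ℝ) ≤ N := by exact_mod_cast hkN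
    gcongr
  have h : powerAverage T N x - x = (N : 𝕜)⁻¹ • ∑ k ∈ Finset.range N, ((T ^ k) x - x) := by
    rw [powerAverage_apply, Finset.sum_sub_distrib, smul_sub, Finset.sum_const, Finset.card_range,
      ← Nat.cast_smul_eq_nsmul 𝕜, inv_smul_smul₀ hNk]
  rw [h, norm_smul, norm_inv, RCLike.norm_natCast, inv_mul_le_iff₀ hN']
  refine (norm_sum_le_of_le _ hk).trans_eq ?_
  simp

/-- Telescoping: the error of `m` steps is the sum of the one-step errors, each propagated by a
power of `T`. An operator commuting with `T` passes through the propagation. -/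
theorem norm_apply_pow_sub_le {P : E →L[𝕜] E} (hP : Commute P T) {m : ℕ}
    (hM : ∀ k ≤ m, ∀ x, ‖(T ^ k) x‖ ≤ M * ‖x‖) (a : ℕ → E) :
    ‖P ((T ^ m) (a 0) - a m)‖ ≤ M * ∑ k ∈ Finset.range m, ‖P (T (a k) - a (k + 1))‖ := by
  have h : (T ^ m) (a 0) - a m
      = ∑ k ∈ Finset.range m, (T ^ (m - (k + 1))) (T (a k) - a (k + 1)) := by
    have h1 := Finset.sum_range_sub' (fun k => (T ^ (m - k)) (a k)) m
    simp only [Nat.sub_zero, Nat.sub_self, pow_zero, one_apply_eq_self] at h1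
    rw [← h1]
    refine Finset.sum_congr rfl fun k hk => ?_
    have hk' : m - k = m - (k + 1) + 1 := by have := Finset.mem_range.1 hk; omega
    rw [map_sub, hk', pow_succ, mul_apply_eq_comp]
  rw [h, map_sum, Finset.mul_sum]
  refine norm_sum_le_of_le _ fun k _ => ?_
  have hc : P ((T ^ (m - (k + 1))) (T (a k) - a (k + 1)))
      = (T ^ (m - (k + 1))) (P (T (a k) - a (k + 1))) :=
    congrArg (fun S : E →L[𝕜] E => S (T (a k) - a (k + 1))) (hP.pow_right (m - (k + 1))).eq
  rw [hc]
  exact hM _ (by omega) _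

end PowerAverage

/-! ### Averages over a fixed time span -/

section TimeAverage

variable {𝕜 E : Type*} [RCLike 𝕜] [NormedAddCommGroup E] [NormedSpace 𝕜 E]

/-- The average of the powers `F τ ^ k` over the times `k τ` in `[0, δ)`, rounded to a whole number
of steps; it is `0` when `τ > δ`. It plays the role of the mean `δ⁻¹ ∫₀^δ` of the semigroup that `F` would approximate. -/
noncomputable def timeAverage (F : ℝ≥0 → E →L[𝕜] E) (δ τ : ℝ≥0) : E →L[𝕜] E :=
  powerAverage (F τ) ⌊δ / τ⌋₊

/-- `M` bounds all powers `F τ ^ k` with `k τ ≤ s`, including `k = 0`. -/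
def IsPowerBound (F : ℝ≥0 → E →L[𝕜] E) (s : ℝ≥0) (M : ℝ) : Prop :=
  ∀ (τ : ℝ≥0) (k : ℕ), (k : ℝ≥0) * τ ≤ s → ∀ x, ‖(F τ ^ k) x‖ ≤ M * ‖x‖

theorem ClassE.exists_isPowerBound {F : ℝ≥0 → E →L[𝕜] E} (hF : ClassE F) (s : ℝ≥0) :
    ∃ M : ℝ, 0 ≤ M ∧ IsPowerBound F s M := by
  obtain ⟨b, hb, h⟩ := hF.2 s
  refine ⟨max b 1, by positivity, fun τ k hk x => ?_⟩
  rcases Nat.eq_zero_or_pos k with rfl | hk0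
  · simpa using mul_le_mul_of_nonneg_right (le_max_right b 1) (norm_nonneg x)
  · refine (h _ ⟨1, k, τ, le_rfl, hk0, by simpa using hk, by simp⟩ x).trans ?_
    gcongr
    exact le_max_left _ _

variable {F : ℝ≥0 → E →L[𝕜] E} {s δ τ : ℝ≥0} {M : ℝ}

theorem floor_div_mul_le (hτ : 0 < τ) : (⌊δ / τ⌋₊ : ℝ≥0) * τ ≤ δ :=
  (le_div_iff₀ hτ).1 (Nat.floor_le (by positivity))

theorem one_le_floor_div (hτ : 0 < τ) (hτδ : τ ≤ δ) : 1 ≤ ⌊δ / τ⌋₊ :=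
  Nat.one_le_floor_iff _ |>.2 ((one_le_div hτ).2 hτδ)

theorem half_le_floor_div_mul (hτ : 0 < τ) (hτδ : τ ≤ δ) :
    (δ : ℝ) / 2 ≤ (⌊δ / τ⌋₊ : ℝ) * τ := by
  have h1 : δ < ((⌊δ / τ⌋₊ : ℝ≥0) + 1) * τ := (div_lt_iff₀ hτ).1 (Nat.lt_floor_add_one _)
  have h1' : (δ : ℝ) < ((⌊δ / τ⌋₊ : ℝ) + 1) * τ := by exact_mod_cast h1
  have h2 : (1 : ℝ) ≤ (⌊δ / τ⌋₊ : ℝ) := by exact_mod_cast one_le_floor_div hτ hτδ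
  have h3 : (0 : ℝ) < τ := hτ
  nlinarith

theorem IsPowerBound.pow_le (hM : IsPowerBound F s M) (hδ : δ ≤ s) (hτ : 0 < τ) :
    ∀ k ≤ ⌊δ / τ⌋₊, ∀ x, ‖(F τ ^ k) x‖ ≤ M * ‖x‖ := by
  intro k hk
  refine hM τ k (le_trans ?_ ((floor_div_mul_le hτ).trans hδ))
  have : (k : ℝ≥0) ≤ (⌊δ / τ⌋₊ : ℝ≥0) := by exact_mod_cast hk
  gcongr

theorem IsPowerBound.norm_timeAverage_le (hM : IsPowerBound F s M) (hδ : δ ≤ s) (hτ : 0 < τ)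
    (hτδ : τ ≤ δ) (x : E) : ‖timeAverage F δ τ x‖ ≤ M * ‖x‖ :=
  norm_powerAverage_apply_le (one_le_floor_div hτ hτδ) (hM.pow_le hδ hτ) x

theorem norm_diffQuot (hF0 : F 0 = 1) (x : E) :
    ‖diffQuot F τ x‖ = (τ : ℝ)⁻¹ * ‖F τ x - x‖ := by
  rw [diffQuot, norm_smul, norm_inv, RCLike.norm_ofReal, NNReal.abs_eq, hF0, one_apply_eq_self]

/-- Averaging over a fixed time span makes the difference quotients bounded uniformly in `τ`:
the sum telescopes to `(F τ ^ N - 1) / (N τ)`, where `N τ ≥ δ / 2`. -/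
theorem IsPowerBound.norm_timeAverage_diffQuot_le (hM : IsPowerBound F s M) (hM0 : 0 ≤ M)
    (hF0 : F 0 = 1) (hδ : δ ≤ s) (hτ : 0 < τ) (hτδ : τ ≤ δ) (x : E) :
    ‖timeAverage F δ τ (diffQuot F τ x)‖ ≤ 2 * (M + 1) / δ * ‖x‖ := by
  have hτ' : (0 : ℝ) < τ := hτ
  have hδ' : (0 : ℝ) < δ := hτ.trans_le hτδ
  rw [diffQuot, map_smul, norm_smul, norm_inv, RCLike.norm_ofReal, NNReal.abs_eq, hF0,
    one_apply_eq_self]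
  have h1 := norm_powerAverage_apply_sub_le (hM.pow_le hδ hτ) x
  have h2 := half_le_floor_div_mul hτ hτδ
  have h3 : (⌊δ / τ⌋₊ : ℝ) ≠ 0 := by
    have := one_le_floor_div hτ hτδ
    positivity
  calc (τ : ℝ)⁻¹ * ‖timeAverage F δ τ (F τ x - x)‖
      ≤ (τ : ℝ)⁻¹ * ((⌊δ / τ⌋₊ : ℝ)⁻¹ * ((M + 1) * ‖x‖)) :=
        mul_le_mul_of_nonneg_left h1 (by positivity)
    _ = ((⌊δ / τ⌋₊ : ℝ) * τ)⁻¹ * ((M + 1) * ‖x‖) := by rw [mul_inv]; ring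
    _ ≤ ((δ : ℝ) / 2)⁻¹ * ((M + 1) * ‖x‖) := by gcongr
    _ = 2 * (M + 1) / δ * ‖x‖ := by rw [inv_div]; ring

theorem IsPowerBound.norm_timeAverage_sub_self_le (hM : IsPowerBound F s M) (hM0 : 0 ≤ M)
    (hF0 : F 0 = 1) (hδ : δ ≤ s) (hτ : 0 < τ) (hτδ : τ ≤ δ) (x : E) :
    ‖timeAverage F δ τ x - x‖ ≤ δ * (M * ‖diffQuot F τ x‖) := by
  have hτ' : (0 : ℝ) < τ := hτ
  have hfl : (⌊δ / τ⌋₊ : ℝ) * τ ≤ δ := by exact_mod_cast floor_div_mul_le (δ := δ) hτ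
  have heq : ‖F τ x - x‖ = τ * ‖diffQuot F τ x‖ := by
    rw [norm_diffQuot hF0, mul_inv_cancel_left₀ hτ'.ne']
  refine (norm_powerAverage_sub_self_le (one_le_floor_div hτ hτδ) hM0 (hM.pow_le hδ hτ) x).trans ?_
  calc (⌊δ / τ⌋₊ : ℝ) * (M * ‖F τ x - x‖)
      = ((⌊δ / τ⌋₊ : ℝ) * τ) * (M * ‖diffQuot F τ x‖) := by rw [heq]; ring
    _ ≤ δ * (M * ‖diffQuot F τ x‖) := by gcongr

theorem eventually_pos_and_le (hδ : 0 < δ) : ∀ᶠ τ : ℝ≥0 in 𝓝[>] 0, 0 < τ ∧ τ ≤ δ :=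
  Ioc_mem_nhdsGT hδ

/-- Consistency on the closure of `Z`: the difference quotients themselves need not converge there,
but their averages do, by the uniform bound and the convergence on the domain of `Z`. -/
theorem IsPowerBound.tendsto_timeAverage_diffQuot_sub {Z : E →ₗ.[𝕜] E}
    (hgen : ∀ u : Z.domain, Tendsto (fun τ => diffQuot F τ (u : E)) (𝓝[>] 0) (𝓝 (Z u)))
    (hM : IsPowerBound F s M) (hM0 : 0 ≤ M) (hF0 : F 0 = 1) (hδ0 : 0 < δ) (hδ : δ ≤ s) {x y : E}
    (hxy : (x, y) ∈ Z.graph.topologicalClosure) :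
    Tendsto (fun τ => timeAverage F δ τ (diffQuot F τ x - y)) (𝓝[>] 0) (𝓝 0) := by
  rw [Metric.tendsto_nhds]
  intro ε hε
  have hδ' : (0 : ℝ) < δ := hδ0
  set L : ℝ := 2 * (M + 1) / δ with hL
  have hL0 : 0 ≤ L := by positivity
  obtain ⟨η, hη, hηε⟩ : ∃ η > 0, (L + 2 * M) * η < ε := by
    refine ⟨ε / (L + 2 * M + 1), by positivity, ?_⟩
    rw [mul_div_assoc', div_lt_iff₀ (by positivity)]
    nlinarith
  obtain ⟨⟨u, v⟩, huv, hdist⟩ := Metric.mem_closure_iff.1 hxy η hη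
  obtain ⟨w, rfl, rfl⟩ := (LinearPMap.mem_graph_iff Z).1 huv
  rw [Prod.dist_eq, max_lt_iff, dist_eq_norm, dist_eq_norm] at hdist
  obtain ⟨hx, hy⟩ := hdist
  simp only at hx hy
  filter_upwards [eventually_pos_and_le hδ0, (Metric.tendsto_nhds.1 (hgen w)) η hη]
    with τ ⟨hτ, hτδ⟩ hw
  rw [dist_eq_norm] at hw
  have hsplit : timeAverage F δ τ (diffQuot F τ x - y)
      = timeAverage F δ τ (diffQuot F τ (x - w)) + timeAverage F δ τ (diffQuot F τ w - Z w)
        - timeAverage F δ τ (y - Z w) := by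
    have hd : diffQuot F τ x = diffQuot F τ (x - w) + diffQuot F τ w := by
      rw [← diffQuot_add, sub_add_cancel]
    rw [← map_add, ← map_sub, hd]
    congr 1
    abel
  rw [dist_zero_right, hsplit]
  have h1 := hM.norm_timeAverage_diffQuot_le hM0 hF0 hδ hτ hτδ (x - w)
  have h2 := hM.norm_timeAverage_le hδ hτ hτδ (diffQuot F τ w - Z w)
  have h3 := hM.norm_timeAverage_le hδ hτ hτδ (y - Z w)
  rw [← hL] at h1
  have h1' := mul_le_mul_of_nonneg_left hx.le hL0
  have h2' := mul_le_mul_of_nonneg_left hw.le hM0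
  have h3' := mul_le_mul_of_nonneg_left hy.le hM0
  refine (norm_sub_le _ _).trans_lt ?_
  have h4 := norm_add_le (timeAverage F δ τ (diffQuot F τ (x - w)))
    (timeAverage F δ τ (diffQuot F τ w - Z w))
  linarith

/-- Averages over short time spans are close to the identity, uniformly on compact sets. -/
theorem IsPowerBound.exists_norm_timeAverage_sub_self_le {Z : E →ₗ.[𝕜] E}
    (hdense : Dense (Z.domain : Set E))
    (hgen : ∀ u : Z.domain, Tendsto (fun τ => diffQuot F τ (u : E)) (𝓝[>] 0) (𝓝 (Z u)))
    (hM : IsPowerBound F s M) (hM0 : 0 ≤ M) (hF0 : F 0 = 1) (hs : 0 < s) {K : Set E}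
    (hK : IsCompact K) {ε : ℝ} (hε : 0 < ε) :
    ∃ δ₀ > 0, ∀ δ : ℝ≥0, 0 < δ → δ ≤ δ₀ →
      ∀ᶠ τ in 𝓝[>] 0, ∀ x ∈ K, ‖timeAverage F δ τ x - x‖ ≤ ε := by
  refine hK.induction_on (p := fun K => ∃ δ₀ > 0, ∀ δ : ℝ≥0, 0 < δ → δ ≤ δ₀ →
      ∀ᶠ τ in 𝓝[>] 0, ∀ x ∈ K, ‖timeAverage F δ τ x - x‖ ≤ ε) ?_ ?_ ?_ ?_
  · exact ⟨1, one_pos, by simp⟩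
  · rintro A B hAB ⟨δ₀, h0, h⟩
    exact ⟨δ₀, h0, fun δ hδ hδ₀ => (h δ hδ hδ₀).mono fun τ hτ x hx => hτ x (hAB hx)⟩
  · rintro A B ⟨δ₁, h1, hA⟩ ⟨δ₂, h2, hB⟩
    refine ⟨min δ₁ δ₂, lt_min h1 h2, fun δ hδ hδ₀ => ?_⟩
    filter_upwards [hA δ hδ (hδ₀.trans (min_le_left _ _)), hB δ hδ (hδ₀.trans (min_le_right _ _))]
      with τ hτA hτB x hx
    exact hx.elim (hτA x) (hτB x)
  · intro x _
    have hη : 0 < ε / (2 * (M + 1)) := by positivity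
    obtain ⟨v, hv, hxv⟩ := hdense.exists_dist_lt x hη
    -- On the ball about `v`, replacing a point by `v` costs at most `ε / 2`; the choice of `q` gives
    -- `M δ (‖Z v‖ + 1) ≤ ε / 2` for `δ ≤ q`, which bounds the cost at `v` itself.
    set q : ℝ := ε / (2 * (M + 1) * (‖Z ⟨v, hv⟩‖ + 1)) with hq
    have hq0 : 0 < q := by positivity
    refine ⟨Metric.ball v (ε / (2 * (M + 1))), mem_nhdsWithin_of_mem_nhds
      (Metric.isOpen_ball.mem_nhds hxv), min s q.toNNReal,
      lt_min hs (Real.toNNReal_pos.2 hq0), fun δ hδ hδ₀ => ?_⟩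
    have hδs := hδ₀.trans (min_le_left _ _)
    have hδq : (δ : ℝ) ≤ q := by
      have := hδ₀.trans (min_le_right _ _)
      exact (Real.le_toNNReal_iff_coe_le hq0.le).1 this
    filter_upwards [eventually_pos_and_le hδ,
      (hgen ⟨v, hv⟩).norm.eventually (gt_mem_nhds (lt_add_one ‖Z ⟨v, hv⟩‖))]
      with τ ⟨hτ, hτδ⟩ hw z hz
    rw [Metric.mem_ball, dist_eq_norm] at hz
    have h1 := hM.norm_timeAverage_sub_self_le hM0 hF0 hδs hτ hτδ v
    have h2 := hM.norm_timeAverage_le hδs hτ hτδ (z - v)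
    have hsplit : timeAverage F δ τ z - z
        = timeAverage F δ τ (z - v) + (timeAverage F δ τ v - v) - (z - v) := by
      rw [map_sub]; abel
    have h3 : (δ : ℝ) * (M * ‖diffQuot F τ v‖) ≤ ε / 2 := by
      calc (δ : ℝ) * (M * ‖diffQuot F τ v‖)
          ≤ q * ((M + 1) * (‖Z ⟨v, hv⟩‖ + 1)) := by
            gcongr
            linarith
        _ = ε / 2 := by rw [hq]; field_simp
    have h4 : (M + 1) * ‖z - v‖ ≤ ε / 2 := by
      calc (M + 1) * ‖z - v‖ ≤ (M + 1) * (ε / (2 * (M + 1))) := by gcongr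
        _ = ε / 2 := by field_simp
    rw [hsplit]
    refine (norm_sub_le _ _).trans ?_
    have h5 := norm_add_le (timeAverage F δ τ (z - v)) (timeAverage F δ τ v - v)
    linarith

end TimeAverage

/-! ### From step sizes to uniform convergence in time -/

section Uniform

variable {𝕜 E : Type*} [RCLike 𝕜] [NormedAddCommGroup E] [NormedSpace 𝕜 E]
  {F : ℝ≥0 → E →L[𝕜] E} {f : ℝ → E} {t₀ : ℝ≥0}

/-- Steps `t / n` with `t ≤ t₀` become uniformly small, so a bound for all small step sizes is
uniform convergence in `t`. -/
theorem tendstoUniformlyOn_of_eventually_norm_error_le (hF0 : F 0 = 1)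
    (h : ∀ ε > 0, ∀ᶠ τ : ℝ≥0 in 𝓝[>] 0, ∀ m : ℕ, (m : ℝ≥0) * τ ≤ t₀ →
      ‖(F τ ^ m) (f 0) - f (m * τ)‖ ≤ ε) :
    TendstoUniformlyOn (fun (n : ℕ) (t : ℝ≥0) => (F (t / n) ^ n) (f 0)) (fun t : ℝ≥0 => f t) atTop
      (Icc 0 t₀) := by
  rw [Metric.tendstoUniformlyOn_iff]
  intro ε hε
  obtain ⟨ρ, hρ, hρε⟩ := mem_nhdsGT_iff_exists_Ioo_subset.1 (h (ε / 2) (by positivity))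
  have hlim : Tendsto (fun n : ℕ => t₀ / (n : ℝ≥0)) atTop (𝓝 0) :=
    by
    rw [← NNReal.tendsto_coe]
    simpa using tendsto_const_div_atTop_nhds_zero_nat (t₀ : ℝ)
  filter_upwards [hlim.eventually (gt_mem_nhds hρ), eventually_gt_atTop 0] with n hn hn0 t ht
  have hn0' : (n : ℝ≥0) ≠ 0 := by exact_mod_cast hn0.ne'
  rcases eq_zero_or_pos t with rfl | ht0
  · simpa [hF0] using hε
  · have hmem : t / n ∈ Ioo 0 ρ :=
      ⟨by positivity, lt_of_le_of_lt (by gcongr; exact ht.2) hn⟩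
    have hnt : (n : ℝ≥0) * (t / n) = t := mul_div_cancel₀ t hn0'
    have h1 := hρε hmem n (hnt.le.trans ht.2)
    have h2 : (n : ℝ) * ((t / n : ℝ≥0) : ℝ) = t := by exact_mod_cast congrArg NNReal.toReal hnt
    rw [h2] at h1
    rw [dist_comm, dist_eq_norm]
    linarith

end Uniform

/-! ### Convergence along a solution with bounded derivative -/

section Convergence

open MeasureTheory

variable {𝕜 E : Type*} [RCLike 𝕜] [NormedAddCommGroup E] [NormedSpace 𝕜 E]
  [NormedSpace ℝ E] [CompleteSpace E]

/-- The one-step error of `T` along `f`, seen through an operator `P`. The vector `P (T x - x)` is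
`τ • Q x`, and `Q` is bounded, so that `f a` may be replaced by `f r` under the integral. -/
theorem norm_apply_step_le {T P Q : E →L[𝕜] E} {f f' : ℝ → E} {a τ C L : ℝ} (hτ : 0 ≤ τ)
    (hPQ : ∀ x, P (T x - x) = τ • Q x) (hL0 : 0 ≤ L) (hL : ∀ x, ‖Q x‖ ≤ L * ‖x‖)
    (hcont : ContinuousOn f (Icc a (a + τ)))
    (hderiv : ∀ r ∈ Ioo a (a + τ), HasDerivAt f (f' r) r)
    (hint : IntervalIntegrable f' volume a (a + τ))
    (hlip : ∀ r ∈ Icc a (a + τ), ‖f r - f a‖ ≤ C * τ) :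
    ‖P (T (f a) - f (a + τ))‖
      ≤ (∫ r in a..(a + τ), ‖Q (f r) - P (f' r)‖) + τ * (L * (C * τ)) := by
  have hle : a ≤ a + τ := by linarith
  have hFTC := intervalIntegral.integral_eq_sub_of_hasDerivAt_of_le hle hcont hderiv hint
  have hPint : IntervalIntegrable (fun r => P (f' r)) volume a (a + τ) :=
    ⟨P.integrable_comp hint.1, P.integrable_comp hint.2⟩
  have hQint : IntervalIntegrable (fun r => Q (f r)) volume a (a + τ) :=
    (Q.continuous.comp_continuousOn (uIcc_of_le hle ▸ hcont)).intervalIntegrable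
  have heq : P (T (f a) - f (a + τ)) = ∫ r in a..(a + τ), (Q (f a) - P (f' r)) := by
    rw [intervalIntegral.integral_sub intervalIntegrable_const hPint,
      intervalIntegral.integral_const, P.intervalIntegral_comp_comm hint, hFTC, add_sub_cancel_left,
      ← hPQ, ← map_sub]
    congr 1
    abel
  have hconst : ∫ _ in a..(a + τ), L * (C * τ) = τ * (L * (C * τ)) := by
    rw [intervalIntegral.integral_const, add_sub_cancel_left, smul_eq_mul]
  rw [heq, ← hconst, ← intervalIntegral.integral_add (hQint.sub hPint).norm
    intervalIntegrable_const]
  refine (intervalIntegral.norm_integral_le_integral_norm hle).trans ?_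
  refine intervalIntegral.integral_mono_on hle (intervalIntegrable_const.sub hPint).norm
    ((hQint.sub hPint).norm.add intervalIntegrable_const) fun r hr => ?_
  have h1 : ‖Q (f a) - Q (f r)‖ ≤ L * (C * τ) := by
    rw [← map_sub, ← neg_sub, map_neg, norm_neg]
    exact (hL _).trans (mul_le_mul_of_nonneg_left (hlip r hr) hL0)
  calc ‖Q (f a) - P (f' r)‖ = ‖(Q (f r) - P (f' r)) + (Q (f a) - Q (f r))‖ := by congr 1; abel
    _ ≤ _ := (norm_add_le _ _).trans (by gcongr)

variable [IsScalarTower ℝ 𝕜 E] {F : ℝ≥0 → E →L[𝕜] E} {Z : E →ₗ.[𝕜] E} {f : ℝ → E} {t₀ : ℝ≥0}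
  {C : ℝ}

/-- Convergence of the averaged error. The one-step errors sum to an integral over `[0, t₀]` whose
integrand tends to `0` pointwise and boundedly. -/
theorem IsPowerBound.eventually_norm_timeAverage_error_le {s δ : ℝ≥0} {M : ℝ}
    (hgen : ∀ u : Z.domain, Tendsto (fun τ => diffQuot F τ (u : E)) (𝓝[>] 0) (𝓝 (Z u)))
    (hM : IsPowerBound F s M) (hM0 : 0 ≤ M) (hF0 : F 0 = 1) (hδ0 : 0 < δ) (hδ : δ ≤ s)
    (ht₀ : t₀ ≤ s) (hcont : ContinuousOn f (Icc 0 (t₀ : ℝ)))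
    (hdiff : ∀ r ∈ Ioc 0 (t₀ : ℝ), DifferentiableAt ℝ f r)
    (hbound : ∀ r ∈ Ioc 0 (t₀ : ℝ), ‖deriv f r‖ ≤ C)
    (hgraph : ∀ r ∈ Ioc 0 (t₀ : ℝ), (f r, deriv f r) ∈ Z.graph.topologicalClosure)
    {ε : ℝ} (hε : 0 < ε) :
    ∀ᶠ τ : ℝ≥0 in 𝓝[>] 0, ∀ m : ℕ, (m : ℝ≥0) * τ ≤ t₀ →
      ‖timeAverage F δ τ ((F τ ^ m) (f 0) - f (m * τ))‖ ≤ ε := by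
  have ht0 : (0 : ℝ) ≤ t₀ := t₀.2
  have hδ' : (0 : ℝ) < δ := hδ0
  have hC : ∃ C' : ℝ, 0 ≤ C' ∧ ∀ r ∈ Ioc 0 (t₀ : ℝ), ‖deriv f r‖ ≤ C' :=
    ⟨max C 0, le_max_right _ _, fun r hr => (hbound r hr).trans (le_max_left _ _)⟩
  clear hbound
  obtain ⟨C, hC0, hbound⟩ := hC
  set L : ℝ := 2 * (M + 1) / δ with hL
  have hL0 : 0 ≤ L := by positivity
  have hint : IntervalIntegrable (deriv f) volume 0 t₀ := by
    rw [intervalIntegrable_iff_integrableOn_Ioc_of_le ht0]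
    exact Measure.integrableOn_of_bounded (by simp) (aestronglyMeasurable_deriv f _)
      ((ae_restrict_iff' measurableSet_Ioc).2 (ae_of_all _ hbound))
  obtain ⟨B, hB⟩ := isCompact_Icc.exists_bound_of_continuousOn hcont
  let Q : ℝ≥0 → E →L[𝕜] E := fun τ =>
    (timeAverage F δ τ).comp ((((τ : ℝ) : 𝕜))⁻¹ • (F τ - F 0))
  have hQ : ∀ τ x, Q τ x = timeAverage F δ τ (diffQuot F τ x) := fun τ x => rfl
  let φ : ℝ≥0 → ℝ → ℝ := fun τ r => ‖Q τ (f r) - timeAverage F δ τ (deriv f r)‖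
  have hφint : ∀ τ, IntervalIntegrable (φ τ) volume 0 t₀ := by
    intro τ
    have hPint : IntervalIntegrable (fun r => timeAverage F δ τ (deriv f r)) volume 0 t₀ :=
      ⟨(timeAverage F δ τ).integrable_comp hint.1, (timeAverage F δ τ).integrable_comp hint.2⟩
    have hQint : IntervalIntegrable (fun r => Q τ (f r)) volume 0 t₀ :=
      ((Q τ).continuous.comp_continuousOn (uIcc_of_le ht0 ▸ hcont)).intervalIntegrable
    exact (hQint.sub hPint).norm
  have hlim : Tendsto (fun τ => ∫ r in (0 : ℝ)..t₀, φ τ r) (𝓝[>] 0) (𝓝 0) := by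
    have h := intervalIntegral.tendsto_integral_filter_of_dominated_convergence (μ := volume)
      (a := 0) (b := t₀) (F := φ) (f := fun _ => (0 : ℝ)) (l := 𝓝[>] (0 : ℝ≥0))
      (fun _ => L * B + M * C) ?_ ?_ intervalIntegrable_const ?_
    · simpa using h
    · refine Eventually.of_forall fun τ => ?_
      rw [uIoc_of_le ht0]
      exact (hφint τ).1.aestronglyMeasurable
    · filter_upwards [eventually_pos_and_le hδ0] with τ ⟨hτ, hτδ⟩
      refine ae_of_all _ fun r hr => ?_
      rw [uIoc_of_le ht0] at hr
      rw [Real.norm_of_nonneg (norm_nonneg _)]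
      refine (norm_sub_le _ _).trans (add_le_add ?_ ?_)
      · refine (hM.norm_timeAverage_diffQuot_le hM0 hF0 hδ hτ hτδ _).trans ?_
        exact mul_le_mul_of_nonneg_left (hB r (Ioc_subset_Icc_self hr)) hL0
      · refine (hM.norm_timeAverage_le hδ hτ hτδ _).trans ?_
        exact mul_le_mul_of_nonneg_left (hbound r hr) hM0
    · refine ae_of_all _ fun r hr => ?_
      rw [uIoc_of_le ht0] at hr
      have h := (hM.tendsto_timeAverage_diffQuot_sub hgen hM0 hF0 hδ0 hδ (hgraph r hr)).norm
      simpa only [φ, hQ, map_sub, norm_zero] using h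
  have hlip : ∀ a b : ℝ, 0 ≤ a → a ≤ b → b ≤ t₀ → ‖f b - f a‖ ≤ C * (b - a) := by
    intro a b ha hab hb
    rw [← intervalIntegral.integral_eq_sub_of_hasDerivAt_of_le hab
      (hcont.mono (Icc_subset_Icc ha hb))
      (fun r hr => (hdiff r ⟨ha.trans_lt hr.1, hr.2.le.trans hb⟩).hasDerivAt)
      (hint.mono_set (by
        rw [uIcc_of_le hab, uIcc_of_le ht0]; exact Icc_subset_Icc ha hb))]
    refine (intervalIntegral.norm_integral_le_of_norm_le_const (C := C) fun r hr => ?_).trans_eq ?_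
    · rw [uIoc_of_le hab] at hr
      exact hbound r ⟨ha.trans_lt hr.1, hr.2.trans hb⟩
    · rw [abs_of_nonneg (by linarith)]
  have hlim2 : Tendsto (fun τ : ℝ≥0 => M * ((∫ r in (0 : ℝ)..t₀, φ τ r)
      + t₀ * (L * (C * (τ : ℝ))))) (𝓝[>] 0) (𝓝 0) := by
    have hsmall : Tendsto (fun s : ℝ≥0 => (s : ℝ)) (𝓝[>] 0) (𝓝 0) :=
      (NNReal.continuous_coe.tendsto 0).mono_left nhdsWithin_le_nhds
    simpa using (hlim.add (((hsmall.const_mul C).const_mul L).const_mul (t₀ : ℝ))).const_mul M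
  filter_upwards [eventually_pos_and_le hδ0, hlim2.eventually (gt_mem_nhds hε)]
    with τ ⟨hτ, hτδ⟩ hτε m hm
  have hτ' : (0 : ℝ) < τ := hτ
  have hm' : (m : ℝ) * τ ≤ t₀ := by exact_mod_cast hm
  have hkm : ∀ k < m, ((k : ℝ) + 1) * τ ≤ t₀ := fun k hk => by
    refine le_trans ?_ hm'
    gcongr
    exact_mod_cast hk
  have hstep : ∀ k ∈ Finset.range m,
      ‖timeAverage F δ τ (F τ (f (k * τ)) - f ((k + 1 : ℕ) * τ))‖
        ≤ (∫ r in ((k : ℝ) * τ)..((k + 1 : ℕ) * τ), φ τ r) + τ * (L * (C * τ)) := by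
    intro k hk
    have hk' := hkm k (Finset.mem_range.1 hk)
    have hk0 : (0 : ℝ) ≤ k * τ := by positivity
    have hadd : ((k + 1 : ℕ) : ℝ) * τ = k * τ + τ := by push_cast; ring
    rw [hadd]
    have hb : (k : ℝ) * τ + τ ≤ t₀ := by linarith
    refine norm_apply_step_le (Q := Q τ) hτ'.le (fun x => ?_) hL0
      (fun x => hM.norm_timeAverage_diffQuot_le hM0 hF0 hδ hτ hτδ x)
      (hcont.mono (Icc_subset_Icc hk0 hb))
      (fun r hr => (hdiff r ⟨hk0.trans_lt hr.1, hr.2.le.trans hb⟩).hasDerivAt)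
      (hint.mono_set ?_) fun r hr => ?_
    · have hτk : ((τ : ℝ) : 𝕜) ≠ 0 := by exact_mod_cast hτ'.ne'
      rw [hQ, diffQuot, map_smul, RCLike.real_smul_eq_coe_smul (K := 𝕜), smul_inv_smul₀ hτk, hF0,
        one_apply_eq_self]
    · rw [uIcc_of_le ht0, uIcc_of_le (by linarith)]
      exact Icc_subset_Icc hk0 hb
    · refine (hlip _ r hk0 hr.1 (hr.2.trans hb)).trans ?_
      gcongr
      linarith [hr.2]
  have hpow : ∀ k ≤ m, ∀ x, ‖(F τ ^ k) x‖ ≤ M * ‖x‖ := fun k hk => by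
    refine hM τ k (le_trans ?_ (hm.trans ht₀))
    have : (k : ℝ≥0) ≤ m := by exact_mod_cast hk
    gcongr
  have htel := norm_apply_pow_sub_le (commute_powerAverage (F τ) ⌊δ / τ⌋₊) hpow
    (fun k : ℕ => f (k * τ))
  simp only [Nat.cast_zero, zero_mul] at htel
  refine htel.trans (le_trans ?_ hτε.le)
  refine mul_le_mul_of_nonneg_left ((Finset.sum_le_sum hstep).trans ?_) hM0
  rw [Finset.sum_add_distrib, intervalIntegral.sum_integral_adjacent_intervals
    (a := fun k : ℕ => (k : ℝ) * τ) fun k hk => ?_]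
  · refine add_le_add ?_ ?_
    · simp only [Nat.cast_zero, zero_mul]
      exact intervalIntegral.integral_mono_interval le_rfl (by positivity) hm'
        (ae_of_all _ fun r => norm_nonneg _) (hφint τ)
    · rw [Finset.sum_const, Finset.card_range, nsmul_eq_mul, ← mul_assoc]
      gcongr
  · refine (hφint τ).mono_set ?_
    have h1 := hkm k hk
    have hk0 : (0 : ℝ) ≤ k * τ := by positivity
    have hadd : ((k + 1 : ℕ) : ℝ) * τ = k * τ + τ := by push_cast; ring
    simp only [hadd]
    rw [uIcc_of_le ht0, uIcc_of_le (by linarith)]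
    exact Icc_subset_Icc hk0 (by linarith)

/-- Convergence of Chernoff approximations along a curve whose graph lies in the closure of `Z`. The
average is removed from the error by commuting it past `F τ ^ m`: it is then close to the identity
at the vector `f 0` and, uniformly, on the compact range of `f`. -/
theorem ClassE.eventually_norm_error_le (hF : ClassE F) (hdense : Dense (Z.domain : Set E))
    (hgen : ∀ u : Z.domain, Tendsto (fun τ => diffQuot F τ (u : E)) (𝓝[>] 0) (𝓝 (Z u)))
    (hcont : ContinuousOn f (Icc 0 (t₀ : ℝ)))
    (hdiff : ∀ r ∈ Ioc 0 (t₀ : ℝ), DifferentiableAt ℝ f r)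
    (hbound : ∀ r ∈ Ioc 0 (t₀ : ℝ), ‖deriv f r‖ ≤ C)
    (hgraph : ∀ r ∈ Ioc 0 (t₀ : ℝ), (f r, deriv f r) ∈ Z.graph.topologicalClosure)
    {ε : ℝ} (hε : 0 < ε) :
    ∀ᶠ τ : ℝ≥0 in 𝓝[>] 0, ∀ m : ℕ, (m : ℝ≥0) * τ ≤ t₀ →
      ‖(F τ ^ m) (f 0) - f (m * τ)‖ ≤ ε := by
  obtain ⟨M, hM0, hM⟩ := hF.exists_isPowerBound (t₀ + 1)
  set η : ℝ := ε / (M + 2) with hη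
  have hη0 : 0 < η := by positivity
  obtain ⟨δ₀, hδ₀, h⟩ := hM.exists_norm_timeAverage_sub_self_le hdense hgen hM0 hF.1
    (by positivity) (isCompact_Icc.image_of_continuousOn hcont) hη0
  have hδ : 0 < min δ₀ 1 := lt_min hδ₀ one_pos
  have hδs : min δ₀ 1 ≤ t₀ + 1 := (min_le_right _ _).trans le_add_self
  filter_upwards [h _ hδ (min_le_left _ _), hM.eventually_norm_timeAverage_error_le hgen hM0 hF.1 hδ
    hδs le_self_add hcont hdiff hbound hgraph hη0] with τ hτ hτ' m hm
  have hm' : (m : ℝ) * τ ≤ t₀ := by exact_mod_cast hm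
  have h0 := hτ _ ⟨0, ⟨le_rfl, t₀.2⟩, rfl⟩
  have h1 := hτ _ ⟨m * τ, ⟨by positivity, hm'⟩, rfl⟩
  have h2 := hτ' m hm
  set P := timeAverage F (min δ₀ 1) τ
  have hcomm : P ((F τ ^ m) (f 0)) = (F τ ^ m) (P (f 0)) :=
    congrArg (fun S : E →L[𝕜] E => S (f 0))
      ((commute_powerAverage (F τ) ⌊min δ₀ 1 / τ⌋₊).pow_right m).eq
  have h3 : ‖(F τ ^ m) (P (f 0) - f 0)‖ ≤ M * η :=
    (hM τ m (hm.trans le_self_add) _).trans (mul_le_mul_of_nonneg_left h0 hM0)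
  have hsplit : (F τ ^ m) (f 0) - f (m * τ) = P ((F τ ^ m) (f 0) - f (m * τ))
      + (P (f (m * τ)) - f (m * τ)) - (F τ ^ m) (P (f 0) - f 0) := by
    rw [map_sub, map_sub, hcomm]; abel
  have h4 : (M + 2) * η = ε := by rw [hη]; field_simp
  rw [hsplit]
  refine (norm_sub_le _ _).trans ?_
  have h5 := norm_add_le (P ((F τ ^ m) (f 0) - f (m * τ))) (P (f (m * τ)) - f (m * τ))
  linarith

end Convergence

/-! ### Regularity of local solutions of dissipative equations -/

section Regularity

variable {𝕜 H : Type*} [RCLike 𝕜] [NormedAddCommGroup H] [InnerProductSpace 𝕜 H]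
  [NormedSpace ℝ H]

/-- Two solutions of a dissipative equation do not move apart, in particular a solution and its
translate by `d`. Letting `d → 0`, the speed of a solution is at most its initial speed. -/
theorem IsDissipative.norm_deriv_le {A : H →ₗ.[𝕜] H} (hA : IsDissipative A) {l : ℝ} {f f' : ℝ → H}
    (hderiv : ∀ t ∈ Ico 0 l, HasDerivWithinAt f (f' t) (Ico 0 l) t)
    (hgraph : ∀ t ∈ Ico 0 l, (f t, f' t) ∈ A.graph) {t : ℝ} (ht : t ∈ Ico 0 l) :
    ‖f' t‖ ≤ ‖f' 0‖ := by
  have hmono : ∀ d, 0 < d → t + d < l → ‖f (t + d) - f t‖ ≤ ‖f d - f 0‖ := by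
    intro d hd htd
    let g : ℝ → H := fun r => f (r + d) - f r
    have hsub1 : ∀ r ∈ Icc 0 t, r ∈ Ico 0 l := fun r hr => ⟨hr.1, hr.2.trans_lt ht.2⟩
    have hsub2 : ∀ r ∈ Icc 0 t, r + d ∈ Ico 0 l := fun r hr =>
      ⟨by linarith [hr.1], by linarith [hr.2]⟩
    have hg : ∀ r ∈ Icc 0 t, HasDerivWithinAt g (f' (r + d) - f' r) (Icc 0 t) r := by
      intro r hr
      refine HasDerivWithinAt.sub ?_ ((hderiv r (hsub1 r hr)).mono hsub1)
      have h := (hderiv (r + d) (hsub2 r hr)).scomp r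
        (((hasDerivAt_id r).add_const d).hasDerivWithinAt (s := Icc 0 t)) hsub2
      simpa [Function.comp_def] using h
    have hnsq : ∀ r ∈ Icc 0 t, HasDerivWithinAt (fun r => ‖g r‖ ^ 2)
        (2 * RCLike.re (inner 𝕜 (f' (r + d) - f' r) (g r))) (Icc 0 t) r := by
      intro r hr
      have h := ((hg r hr).inner 𝕜 (hg r hr))
      have h' := (RCLike.reCLM (K := 𝕜)).hasFDerivAt.comp_hasDerivWithinAt r h
      refine (h'.congr_deriv ?_).congr (fun r _ => ?_) ?_
      · simp only [RCLike.reCLM_apply, map_add]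
        rw [inner_re_symm (g r)]
        ring
      · exact (inner_self_eq_norm_sq (𝕜 := 𝕜) (g r)).symm
      · exact (inner_self_eq_norm_sq (𝕜 := 𝕜) (g r)).symm
    have hanti : AntitoneOn (fun r => ‖g r‖ ^ 2) (Icc 0 t) := by
      refine antitoneOn_of_hasDerivWithinAt_nonpos (convex_Icc 0 t)
        (fun r hr => (hnsq r hr).continuousWithinAt)
        (fun r hr => (hnsq r (interior_subset hr)).mono interior_subset) fun r hr => ?_
      have hr' := interior_subset hr
      have hmem : (g r, f' (r + d) - f' r) ∈ A.graph :=
        A.graph.sub_mem (hgraph _ (hsub2 r hr')) (hgraph _ (hsub1 r hr'))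
      have := hA.re_inner_nonpos_of_mem_graph_closure (A.graph.le_topologicalClosure hmem)
      linarith
    have h := hanti ⟨le_rfl, ht.1⟩ ⟨ht.1, le_rfl⟩ ht.1
    have h' : ‖g t‖ ≤ ‖g 0‖ := by
      exact (sq_le_sq₀ (norm_nonneg _) (norm_nonneg _)).1 h
    simpa [g] using h'
  have hquot : ∀ u ∈ Ico 0 l,
      Tendsto (fun d : ℝ => ‖d⁻¹ • (f (u + d) - f u)‖) (𝓝[>] 0) (𝓝 ‖f' u‖) := by
    intro u hu
    have h : HasDerivWithinAt f (f' u) (Ioi u) u := by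
      refine (hderiv u hu).mono_of_mem_nhdsWithin ?_
      filter_upwards [Ioo_mem_nhdsGT hu.2] with r hr using ⟨hu.1.trans hr.1.le, hr.2⟩
    have hshift : Tendsto (fun d : ℝ => u + d) (𝓝[>] 0) (𝓝[>] u) := by
      refine tendsto_nhdsWithin_iff.2 ⟨?_, ?_⟩
      · simpa using ((continuous_const_add u).tendsto 0).mono_left nhdsWithin_le_nhds
      · filter_upwards [self_mem_nhdsWithin] with d hd using lt_add_of_pos_right u hd
    have hslope := ((hasDerivWithinAt_iff_tendsto_slope' self_notMem_Ioi).1 h).comp hshift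
    simpa only [Function.comp_def, slope, add_sub_cancel_left, vsub_eq_sub] using hslope.norm
  have h0 : (0 : ℝ) ∈ Ico 0 l := ⟨le_rfl, ht.1.trans_lt ht.2⟩
  refine le_of_tendsto_of_tendsto (hquot t ht) (hquot 0 h0) ?_
  filter_upwards [Ioo_mem_nhdsGT (sub_pos.2 ht.2)] with d hd
  rw [norm_smul, norm_smul, zero_add]
  exact mul_le_mul_of_nonneg_left (hmono d hd.1 (by linarith [hd.2])) (norm_nonneg _)

end Regularity

/-! ### Convergence along local solutions -/

section LocalSolution

variable {𝕜 H : Type*} [RCLike 𝕜] [NormedAddCommGroup H] [InnerProductSpace 𝕜 H]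
  [CompleteSpace H]

theorem IsDissipative.tendstoUniformlyOn_of_isLocalSolution {Z : H →ₗ.[𝕜] H}
    (hdense : Dense (Z.domain : Set H)) (hdiss : IsDissipative Z) {F : ℝ≥0 → H →L[𝕜] H}
    (hF : ClassE F) (hFZ : (strongDeriv F).domRestrict Z.domain = Z) {l : ℝ} {h : H} {f : ℝ → H}
    (hf : IsLocalSolution Z.closure l h f) {t₀ : ℝ≥0} (ht₀l : (t₀ : ℝ) < l) :
    TendstoUniformlyOn (fun (n : ℕ) (t : ℝ≥0) => (F (t / n) ^ n) h)
      (fun t : ℝ≥0 => f t) atTop (Icc 0 t₀) := by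
  let _ : NormedSpace ℝ H := NormedSpace.restrictScalars ℝ 𝕜 H
  have : IsScalarTower ℝ 𝕜 H := RestrictScalars.isScalarTower ℝ 𝕜 H
  have hgen : ∀ u : Z.domain,
      Tendsto (fun τ => diffQuot F τ (u : H)) (𝓝[>] 0) (𝓝 (Z u)) := by
    intro u
    have hle : Z ≤ strongDeriv F := hFZ ▸ LinearPMap.domRestrict_le
    have hval : Z u = strongDeriv F ⟨u, hle.1 u.2⟩ := hle.2 rfl
    rw [hval]
    exact strongDeriv_spec F ⟨u, hle.1 u.2⟩
  classical
  -- The derivative at `t ∈ [0, l)`, extended by the value `0`.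
  let f' : ℝ → H := fun t => if ht : t ∈ Ico 0 l then Z.closure ⟨f t, hf.mem t ht⟩ else 0
  have hf' : ∀ t ∈ Ico 0 l, HasDerivWithinAt f (f' t) (Ico 0 l) t := by
    intro t ht
    simpa only [f', dif_pos ht] using hf.hasDeriv t ht
  have hgraph : ∀ t ∈ Ico 0 l, (f t, f' t) ∈ Z.closure.graph := by
    intro t ht
    simpa only [f', dif_pos ht] using Z.closure.mem_graph ⟨f t, hf.mem t ht⟩
  have hsub : ∀ r ∈ Ioc 0 (t₀ : ℝ), r ∈ Ico 0 l := fun r hr => ⟨hr.1.le, hr.2.trans_lt ht₀l⟩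
  have hat : ∀ r ∈ Ioc 0 (t₀ : ℝ), HasDerivAt f (f' r) r := fun r hr =>
    (hf' r (hsub r hr)).hasDerivAt (Ico_mem_nhds hr.1 (hsub r hr).2)
  obtain rfl := hf.init
  refine tendstoUniformlyOn_of_eventually_norm_error_le hF.1 fun ε hε =>
    hF.eventually_norm_error_le (C := ‖f' 0‖) hdense hgen
      (fun r hr => (hf' r ⟨hr.1, hr.2.trans_lt ht₀l⟩).continuousWithinAt.mono
        fun x hx => ⟨hx.1, hx.2.trans_lt ht₀l⟩)
      (fun r hr => (hat r hr).differentiableAt) (fun r hr => ?_) (fun r hr => ?_) hε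
  · rw [(hat r hr).deriv]
    exact (hdiss.closure hdense).norm_deriv_le hf' hgraph (hsub r hr)
  · rw [(hat r hr).deriv, (hdiss.isClosable hdense).graph_closure_eq_closure_graph]
    exact hgraph r (hsub r hr)

end LocalSolution

end ChernoffHilbert

theorem corollary9p4 {𝕜 H : Type*} [RCLike 𝕜] [NormedAddCommGroup H] [InnerProductSpace 𝕜 H]
    [CompleteSpace H] (Z : H →ₗ.[𝕜] H) (hdense : Dense (Z.domain : Set H))
    (hdiss : ChernoffHilbert.IsDissipative Z) :
    Z.IsClosable ∧
    (∃ F : ℝ≥0 → H →L[𝕜] H, ChernoffHilbert.ClassF F ∧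
      (ChernoffHilbert.strongDeriv F).domRestrict Z.domain = Z) ∧
    (∀ F : ℝ≥0 → H →L[𝕜] H, ChernoffHilbert.ClassF F →
      (ChernoffHilbert.strongDeriv F).domRestrict Z.domain = Z →
      ∀ (l : ℝ) (h : H) (f : ℝ → H), ChernoffHilbert.IsLocalSolution Z.closure l h f →
        ∀ t₀ : ℝ≥0, 0 < t₀ → (t₀ : ℝ) < l →
          TendstoUniformlyOn (fun (n : ℕ) (t : ℝ≥0) => (F (t / n) ^ n) h)
            (fun t : ℝ≥0 => f t) atTop (Icc 0 t₀)) := by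
  exact ⟨hdiss.isClosable hdense, hdiss.exists_classF hdense,
    fun _ hF hFZ _ _ _ hf _ _ ht₀l =>
      hdiss.tendstoUniformlyOn_of_isLocalSolution hdense hF.1 hFZ hf ht₀l⟩
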